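/- Let $N$ be a finite set and let $V=(\mathbb R^N)^*\cong\mathbb R^N$ be the space of measures on $N$, with $x(S)=\sum_{i\in S}x(\{i\})$ for $S\subseteq N$; let $e_i$ be the Dirac measure at $i\in N$. A polyhedron is a finite intersection of closed half-spaces of $V$, a polytope is the convex hull of a finite set (the empty set is allowed). A polyhedron $P\subset V$ is an $\mathbb A(N)$-polyhedron if for every non-empty face $F$ of $P$ the tangent space $\mathbb R(F-F)$ is spanned by a set of vectors of the form $e_i-e_j$ ($i,j\in N$); an $\mathbb A(N)$-polytope is an $\mathbb A(N)$-polyhedron that is a polytope. A polyhedron is integer if it is given by finitely many inequalities $p(x)\le a$ with $p\in\mathbb Z^N$, $a\in\mathbb Z$, and each of its non-empty faces contains an integer point. A function $b:2^N\to\mathbb R\cup\{+\infty\}$ is submodular if $b(S)+b(T)\ge b(S\cup T)+b(S\cap T)$ for all $S,T\subseteq N$, and then $B(b)=\{x\in V : x(S)\le b(S)\ \text{for all } S\subseteq N,\ x(N)=b(N)\}$ is a base polyhedron. If $b$ is real-valued, $B(b)$ is called a base polytope; if $b$ takes values in $\mathbb Z\cup\{+\infty\}$ (respectively in $\mathbb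 Z$), $B(b)$ is called an integer base polyhedron (respectively an integer base polytope). Proposition 10. The class of $\mathbb A(N)$-polytopes coincides with the class of base polytopes, and the class of integer $\mathbb A(N)$-polytopes coincides with the class of integer base polytopes. Likewise, the class of $\mathbb A(N)$-polyhedra coincides with the class of base polyhedra, and the class of integer $\mathbb A(N)$-polyhedra coincides with the class of integer base polyhedra. -/

import Mathlib

namespace DiscreteConvexity

/-- A polyhedron: the intersection of finitely many closed half-spaces. -/
def IsPolyhedron {V : Type*} [AddCommGroup V] [Module ℝ V] (P : Set V) : Prop :=
  ∃ s : Set ((V →ₗ[ℝ] ℝ) × ℝ), s.Finite ∧ P = {x | ∀ c ∈ s, c.1 x ≤ c.2}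

/-- A polytope: the convex hull of a finite set. -/
def IsPolytope {V : Type*} [AddCommGroup V] [Module ℝ V] (P : Set V) : Prop :=
  ∃ s : Set V, s.Finite ∧ P = convexHull ℝ s

/-- The tangent space `ℝ (F - F)` of a set `F`. -/
def tan {V : Type*} [AddCommGroup V] [Module ℝ V] (F : Set V) : Submodule ℝ V :=
  Submodule.span ℝ {v | ∃ x ∈ F, ∃ y ∈ F, v = x - y}

/-- `P` is a `𝒰`-polyhedron: a polyhedron, the tangent space of each face of which is in `𝒰`. -/
def IsConvexFor {V : Type*} [AddCommGroup V] [Module ℝ V] [TopologicalSpace V]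
    (U : Set (Submodule ℝ V)) (P : Set V) : Prop :=
  IsPolyhedron P ∧ ∀ F : Set V, IsExposed ℝ P F → F.Nonempty → tan F ∈ U

section Measures

variable (N : Type*) [Fintype N] [DecidableEq N]

/-- The vectors `e_i - e_j`, where `e_i` is the Dirac measure at `i`. A measure on the finite set
`N` is given by its values on the points of `N`, so the space of measures is `N → ℝ`. -/
def roots : Set (N → ℝ) :=
  {v | ∃ i j : N, v = Pi.single i (1 : ℝ) - Pi.single j (1 : ℝ)}

/-- The flats: all linear subspaces spanned by sets of vectors `e_i - e_j`. -/
def flats : Set (Submodule ℝ (N → ℝ)) :=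
  {L | ∃ B : Set (N → ℝ), B ⊆ roots N ∧ L = Submodule.span ℝ B}

/-- The `𝔸(N)`-polyhedra. -/
def rootPolyhedra : Set (Set (N → ℝ)) := {P | IsConvexFor (flats N) P}

/-- The `𝔸(N)`-polytopes. -/
def rootPolytopes : Set (Set (N → ℝ)) := {P | P ∈ rootPolyhedra N ∧ IsPolytope P}

variable {N}

/-- A rational polyhedron: the solution set of finitely many inequalities `p(x) ≤ a` with an
integer linear functional `p` and an integer `a`. -/
def IsRationalPolyhedron (P : Set (N → ℝ)) : Prop :=
  ∃ s : Set ((N → ℤ) × ℤ), s.Finite ∧ P = {x | ∀ c ∈ s, ∑ i, (c.1 i : ℝ) * x i ≤ (c.2 : ℝ)}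

/-- An integer polyhedron: it is rational and every non-empty face contains an integer point. -/
def IsIntegerPolyhedron (P : Set (N → ℝ)) : Prop :=
  IsRationalPolyhedron P ∧
    ∀ F : Set (N → ℝ), IsExposed ℝ P F → F.Nonempty → ∃ z : N → ℤ, (fun i => (z i : ℝ)) ∈ F

/-- Submodularity of a set function. -/
def IsSubmodular {R : Type*} [Add R] [LE R] (b : Finset N → R) : Prop :=
  ∀ S T : Finset N, b (S ∪ T) + b (S ∩ T) ≤ b S + b T

/-- `B(b) = {x | x(S) ≤ b(S) for all S ⊆ N, and x(N) = b(N)}`, where `x(S) = ∑ i ∈ S, x i`. -/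
def base (b : Finset N → WithTop ℝ) : Set (N → ℝ) :=
  {x | (∀ S : Finset N, ((∑ i ∈ S, x i : ℝ) : WithTop ℝ) ≤ b S) ∧
    ((∑ i, x i : ℝ) : WithTop ℝ) = b Finset.univ}

variable (N)

/-- Base polyhedra: `B(b)` for submodular `b : 2^N → ℝ ∪ {+∞}`. -/
def basePolyhedra : Set (Set (N → ℝ)) :=
  {P | ∃ b : Finset N → WithTop ℝ, IsSubmodular b ∧ P = base b}

/-- Integer base polyhedra: `B(b)` for submodular `b : 2^N → ℤ ∪ {+∞}`. -/
def integerBasePolyhedra : Set (Set (N → ℝ)) :=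
  {P | ∃ b : Finset N → WithTop ℤ, IsSubmodular b ∧
    P = base fun S => (b S).map fun z : ℤ => (z : ℝ)}

/-- Base polytopes: `B(b)` for submodular `b : 2^N → ℝ`. -/
def basePolytopes : Set (Set (N → ℝ)) :=
  {P | ∃ b : Finset N → ℝ, IsSubmodular b ∧ P = base fun S => ((b S : ℝ) : WithTop ℝ)}

/-- Integer base polytopes: `B(b)` for submodular `b : 2^N → ℤ`. -/
def integerBasePolytopes : Set (Set (N → ℝ)) :=
  {P | ∃ b : Finset N → ℤ, IsSubmodular b ∧ P = base fun S => (((b S : ℤ) : ℝ) : WithTop ℝ)}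

end Measures

end DiscreteConvexity

/-! A polyhedron is compared with its support function on indicator vectors, b(S) = max x(S), with
+∞ where x(S) is unbounded.

Let P be a root polyhedron. If a functional q is larger at y ∈ P than at x ∈ P, then some root e_i -
e_j with q(e_i - e_j) > 0 points from x into P (`exists_root_add_smul_mem`). Hence a maximizer of l
on P also maximizes x(S) for every S on which the coefficients of l exceed those outside S
(`sumOn_le_of_isMax`). For l = 1_S + 1_T this makes b submodular. For l a defining inequality of P,
summation over level sets (`apply_le_of_level`) shows that B(b) satisfies that inequality, so P =
B(b).

Conversely, tangent spaces of faces of B(b) are cut out by tight sets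
(`IsExposed.exists_tan_eq_activeKer`). Submodularity makes the tight sets a lattice, and the vectors
vanishing on a lattice of sets are spanned by roots joining points the lattice does not separate
(`mem_span_roots_of_lattice`).

For integrality, b(S) is read off at an integer point of the face where x(S) is maximal. In the
other direction, a fractional point of a face of B(b) is pushed along roots within that face until
it becomes integer (`exists_integer_mem_of_isExposed_base`). -/

namespace DiscreteConvexity

open Filter Topology

/-! ### Finite systems of linear inequalities: active constraints and attained maxima. -/

section General

variable {V : Type*} [AddCommGroup V] [Module ℝ V]

/-- The set of solutions of a finite system of linear inequalities. -/
def solutions (s : Finset ((V →ₗ[ℝ] ℝ) × ℝ)) : Set V := {x | ∀ c ∈ s, c.1 x ≤ c.2}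

theorem isPolyhedron_iff_exists_solutions {P : Set V} :
    IsPolyhedron P ↔ ∃ s : Finset ((V →ₗ[ℝ] ℝ) × ℝ), P = solutions s := by
  constructor
  · rintro ⟨s, hs, rfl⟩
    exact ⟨hs.toFinset, by simp [solutions]⟩
  · rintro ⟨s, rfl⟩
    exact ⟨s, s.finite_toSet, by simp [solutions]⟩

/-- The constraints which hold with equality at `x`. -/
def active (s : Finset ((V →ₗ[ℝ] ℝ) × ℝ)) (x : V) : Set ((V →ₗ[ℝ] ℝ) × ℝ) :=
  {c | c ∈ s ∧ c.1 x = c.2}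

theorem active_subset (s : Finset ((V →ₗ[ℝ] ℝ) × ℝ)) (x : V) : active s x ⊆ s :=
  fun _ h => h.1

theorem finite_active (s : Finset ((V →ₗ[ℝ] ℝ) × ℝ)) (x : V) : (active s x).Finite :=
  s.finite_toSet.subset (active_subset s x)

/-- The directions along which all constraints active at `x` are constant. -/
def activeKer (s : Finset ((V →ₗ[ℝ] ℝ) × ℝ)) (x : V) : Submodule ℝ V where
  carrier := {v | ∀ c ∈ active s x, c.1 v = 0}
  add_mem' hu hv c hc := by rw [map_add, hu c hc, hv c hc, add_zero]
  zero_mem' c _ := map_zero c.1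
  smul_mem' t v hv c hc := by rw [map_smul, hv c hc, smul_zero]

theorem mem_activeKer {s : Finset ((V →ₗ[ℝ] ℝ) × ℝ)} {x v : V} :
    v ∈ activeKer s x ↔ ∀ c ∈ active s x, c.1 v = 0 := Iff.rfl

/-- Moving along a ray that leaves the polyhedron until a constraint becomes active. -/
theorem exists_add_smul_mem_solutions {s : Finset ((V →ₗ[ℝ] ℝ) × ℝ)} {x v : V}
    (hx : x ∈ solutions s) (h : ∃ c ∈ s, 0 < c.1 v) :
    ∃ t : ℝ, 0 ≤ t ∧ x + t • v ∈ solutions s ∧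
      ∃ c ∈ s, 0 < c.1 v ∧ c.1 (x + t • v) = c.2 := by
  classical
  obtain ⟨c₀, hc₀, hv₀⟩ := h
  obtain ⟨c, hc, hmin⟩ := (s.filter fun c => 0 < c.1 v).exists_min_image
    (fun c => (c.2 - c.1 x) / c.1 v) ⟨c₀, by simp [hc₀, hv₀]⟩
  rw [Finset.mem_filter] at hc
  have ht : 0 ≤ (c.2 - c.1 x) / c.1 v := div_nonneg (sub_nonneg.2 (hx c hc.1)) hc.2.le
  refine ⟨(c.2 - c.1 x) / c.1 v, ht, fun d hd => ?_, c, hc.1, hc.2, ?_⟩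
  · rw [map_add, map_smul, smul_eq_mul]
    rcases le_or_gt (d.1 v) 0 with h | h
    · linarith [hx d hd, mul_nonpos_of_nonneg_of_nonpos ht h]
    · have := hmin d (by simp [hd, h])
      rw [le_div_iff₀ h] at this
      linarith
  · rw [map_add, map_smul, smul_eq_mul, div_mul_cancel₀ _ hc.2.ne']
    ring

theorem eventually_lt_of_lt (s : Finset ((V →ₗ[ℝ] ℝ) × ℝ)) (x v : V) :
    ∀ᶠ t in 𝓝[>] (0 : ℝ), ∀ c ∈ s, c.1 x < c.2 → c.1 (x + t • v) < c.2 := by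
  rw [Filter.eventually_all_finset]
  intro c _
  by_cases h : c.1 x < c.2
  · have : Tendsto (fun t : ℝ => c.1 x + t * c.1 v) (𝓝[>] 0) (𝓝 (c.1 x + 0 * c.1 v)) :=
      (Continuous.tendsto (by fun_prop) 0).mono_left nhdsWithin_le_nhds
    rw [zero_mul, add_zero] at this
    filter_upwards [this.eventually_lt_const h] with t ht _
    simpa using ht
  · exact Eventually.of_forall fun _ h' => absurd h' h

theorem eventually_add_smul_mem_solutions {s : Finset ((V →ₗ[ℝ] ℝ) × ℝ)} {x v : V}
    (hx : x ∈ solutions s) (hv : ∀ c ∈ active s x, c.1 v ≤ 0) :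
    ∀ᶠ t in 𝓝[>] (0 : ℝ), x + t • v ∈ solutions s := by
  filter_upwards [eventually_lt_of_lt s x v, self_mem_nhdsWithin] with t ht ht0 c hc
  rcases (hx c hc).lt_or_eq with h | h
  · exact (ht c hc h).le
  · rw [map_add, map_smul, smul_eq_mul, h]
    linarith [mul_nonpos_of_nonneg_of_nonpos (le_of_lt ht0) (hv c ⟨hc, h⟩)]

theorem exists_add_smul_mem_solutions_of_mem_activeKer {s : Finset ((V →ₗ[ℝ] ℝ) × ℝ)} {x v : V}
    (hx : x ∈ solutions s) (hv : v ∈ activeKer s x) :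
    ∃ t : ℝ, 0 < t ∧ x + t • v ∈ solutions s ∧ x - t • v ∈ solutions s := by
  obtain ⟨t, ⟨h1, h2⟩, h3⟩ := (((eventually_add_smul_mem_solutions hx
    fun c hc => (hv c hc).le).and (eventually_add_smul_mem_solutions (v := -v) hx
    fun c hc => by rw [map_neg, hv c hc, neg_zero])).and self_mem_nhdsWithin).exists
  exact ⟨t, h3, h1, by simpa [sub_eq_add_neg] using h2⟩

/-- Every point can be moved to one where the functional `l` is constrained by the active
inequalities, without decreasing `l`. -/
theorem exists_activeKer_le_ker {s : Finset ((V →ₗ[ℝ] ℝ) × ℝ)} {l : V →ₗ[ℝ] ℝ} {M : ℝ}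
    (hM : ∀ x ∈ solutions s, l x ≤ M) {x : V} (hx : x ∈ solutions s) :
    ∃ y ∈ solutions s, l x ≤ l y ∧ ∀ v ∈ activeKer s y, l v = 0 := by
  induction hn : ((s : Set _) \ active s x).ncard using Nat.strong_induction_on generalizing x with
  | _ n ih =>
    by_cases h : ∀ v ∈ activeKer s x, l v = 0
    · exact ⟨x, hx, le_rfl, h⟩
    push Not at h
    obtain ⟨v, hv, hlv⟩ : ∃ v ∈ activeKer s x, 0 < l v := by
      obtain ⟨v, hv, hlv⟩ := h
      rcases hlv.lt_or_gt with h | h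
      · exact ⟨-v, neg_mem hv, by simpa using h⟩
      · exact ⟨v, hv, h⟩
    have hex : ∃ c ∈ s, 0 < c.1 v := by
      by_contra! hc
      -- If no constraint increases along `v`, the whole ray stays inside; this step length gives
      -- `l` the value `M + 1`.
      have hmem : x + ((M - l x + 1) / l v) • v ∈ solutions s := fun c hcs => by
        rw [map_add, map_smul, smul_eq_mul]
        have : 0 ≤ (M - l x + 1) / l v := div_nonneg (by linarith [hM x hx]) hlv.le
        linarith [mul_nonpos_of_nonneg_of_nonpos this (hc c hcs), hx c hcs]
      have := hM _ hmem
      rw [map_add, map_smul, smul_eq_mul, div_mul_cancel₀ _ hlv.ne'] at this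
      linarith
    obtain ⟨t, ht, hy, c, hc, hcv, hcy⟩ := exists_add_smul_mem_solutions hx hex
    -- Constraints active at `x` stay active along `v`, and `c`, which was not active because it
    -- increases along `v`, joins them.
    have hlt : ((s : Set _) \ active s (x + t • v)).ncard < n := by
      rw [← hn]
      refine Set.ncard_lt_ncard ((Set.ssubset_iff_of_subset ?_).2 ⟨c, ⟨hc, fun h => ?_⟩, ?_⟩)
        (s.finite_toSet.subset Set.sdiff_subset)
      · refine fun d hd => ⟨hd.1, fun h => hd.2 ⟨h.1, ?_⟩⟩
        rw [map_add, map_smul, hv d h, smul_zero, add_zero, h.2]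
      · exact hcv.ne' (hv c h)
      · exact fun h => h.2 ⟨hc, hcy⟩
    obtain ⟨y, hy, hle, hker⟩ := ih _ hlt hy rfl
    refine ⟨y, hy, le_trans ?_ hle, hker⟩
    rw [map_add, map_smul, smul_eq_mul]
    linarith [mul_nonneg ht hlv.le]

/-- A linear functional that is bounded above on a non-empty polyhedron attains its maximum. -/
theorem exists_isMaxOn_solutions {s : Finset ((V →ₗ[ℝ] ℝ) × ℝ)} {l : V →ₗ[ℝ] ℝ} {M : ℝ}
    (hM : ∀ x ∈ solutions s, l x ≤ M) (hne : (solutions s).Nonempty) :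
    ∃ x ∈ solutions s, ∀ y ∈ solutions s, l y ≤ l x := by
  set T := {y ∈ solutions s | ∀ v ∈ activeKer s y, l v = 0}
  -- On `T` the value of `l` depends only on the active set, and there are finitely many of those.
  have hfin : (l '' T).Finite := by
    have hr : ∀ A : Set ((V →ₗ[ℝ] ℝ) × ℝ), ∃ r : ℝ, ∀ y ∈ T, active s y = A → l y = r := by
      intro A
      by_cases h : ∃ y ∈ T, active s y = A
      · obtain ⟨y, hy, rfl⟩ := h
        refine ⟨l y, fun z hz hzy => ?_⟩
        rw [← sub_eq_zero, ← map_sub]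
        refine hy.2 _ fun c hc => ?_
        rw [map_sub, hc.2, (hzy ▸ hc : c ∈ active s z).2, sub_self]
      · exact ⟨0, fun y hy hA => absurd ⟨y, hy, hA⟩ h⟩
    choose g hg using hr
    refine (s.finite_toSet.finite_subsets.image g).subset ?_
    rintro _ ⟨y, hy, rfl⟩
    exact ⟨active s y, active_subset s y, (hg _ y hy rfl).symm⟩
  obtain ⟨x₀, hx₀⟩ := hne
  obtain ⟨y₀, hy₀, -, hk₀⟩ := exists_activeKer_le_ker hM hx₀
  obtain ⟨_, ⟨x, hx, rfl⟩, hmax⟩ := hfin.exists_maximal ⟨l y₀, y₀, ⟨hy₀, hk₀⟩, rfl⟩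
  refine ⟨x, hx.1, fun y hy => ?_⟩
  obtain ⟨z, hz, hle, hk⟩ := exists_activeKer_le_ker hM hy
  exact hle.trans ((le_total (l z) (l x)).elim id fun h => hmax ⟨z, ⟨hz, hk⟩, rfl⟩ h)

/-! ### Faces and their tangent spaces. -/

/-- Exposed subsets are closed under moving inside the polyhedron along directions that keep the
active constraints. -/
theorem IsExposed.add_smul_mem [TopologicalSpace V] {s : Finset ((V →ₗ[ℝ] ℝ) × ℝ)} {F : Set V}
    (hF : IsExposed ℝ (solutions s) F) {x v : V} (hx : x ∈ F) (hv : v ∈ activeKer s x) {t : ℝ}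
    (ht : x + t • v ∈ solutions s) : x + t • v ∈ F := by
  obtain ⟨l, hl⟩ := hF ⟨x, hx⟩
  have hx' := hl ▸ hx
  obtain ⟨ε, hε, h1, h2⟩ := exists_add_smul_mem_solutions_of_mem_activeKer hx'.1 hv
  have h1 := hx'.2 _ h1
  have h2 := hx'.2 _ h2
  -- `l` is maximal at `x`, yet one can move both ways along `v`.
  have hlv : l v = 0 := by
    simp only [map_add, map_sub, map_smul, smul_eq_mul] at h1 h2
    have h : ε * l v = 0 := by linarith
    exact (mul_eq_zero.1 h).resolve_left hε.ne'
  rw [hl]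
  refine ⟨ht, fun y hy => ?_⟩
  rw [map_add, map_smul, hlv, smul_zero, add_zero]
  exact hx'.2 y hy

/-- Here `x` plays the role of a relative interior point. This serves both an arbitrary face, at a
point with fewest active constraints, and the minimal face of a given point. -/
theorem tan_eq_activeKer {s : Finset ((V →ₗ[ℝ] ℝ) × ℝ)} {F : Set V} {x : V} (hx : x ∈ F)
    (hact : ∀ y ∈ F, active s x ⊆ active s y)
    (hmem : ∀ v ∈ activeKer s x, ∃ t : ℝ, 0 < t ∧ x + t • v ∈ F) :
    tan F = activeKer s x := by
  refine le_antisymm (Submodule.span_le.2 ?_) fun v hv => ?_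
  · rintro _ ⟨y, hy, z, hz, rfl⟩ c hc
    rw [map_sub, (hact y hy hc).2, (hact z hz hc).2, sub_self]
  · obtain ⟨t, ht, h⟩ := hmem v hv
    have : v = t⁻¹ • ((x + t • v) - x) := by
      rw [add_sub_cancel_left, smul_smul, inv_mul_cancel₀ ht.ne', one_smul]
    rw [this]
    exact Submodule.smul_mem _ _ (Submodule.subset_span ⟨_, h, x, hx, rfl⟩)

/-- The tangent space of a non-empty face is cut out by the constraints active at one of its
points. -/
theorem IsExposed.exists_tan_eq_activeKer [TopologicalSpace V] {s : Finset ((V →ₗ[ℝ] ℝ) × ℝ)}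
    {F : Set V} (hF : IsExposed ℝ (solutions s) F) (hne : F.Nonempty) :
    ∃ x ∈ F, tan F = activeKer s x := by
  obtain ⟨x, hx, hmin⟩ : ∃ x ∈ F, ∀ y ∈ F, (active s x).ncard ≤ (active s y).ncard := by
    obtain ⟨x, hx⟩ := exists_minimalFor_of_wellFoundedLT (· ∈ F) (fun x => (active s x).ncard) hne
    exact ⟨x, hx.1, fun y hy => (le_total _ _).elim id (hx.2 hy)⟩
  have hFs : F ⊆ solutions s := hF.subset
  refine ⟨x, hx, tan_eq_activeKer hx (fun y hy => ?_) fun v hv => ?_⟩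
  · obtain ⟨l, hl⟩ := hF hne
    -- Only constraints active at both `x` and `y` are active at the midpoint, so minimality of the
    -- active set of `x` forces it into that of `y`.
    set z := (1 / 2 : ℝ) • x + (1 / 2 : ℝ) • y
    have hz : ∀ f : V →ₗ[ℝ] ℝ, f z = (f x + f y) / 2 := fun f => by
      simp only [z, map_add, map_smul, smul_eq_mul]
      ring
    have hzF : z ∈ F := by
      have hx' := hl ▸ hx
      have hy' := hl ▸ hy
      rw [hl]
      refine ⟨fun c hc => ?_, fun w hw => ?_⟩
      · rw [hz]
        linarith [hx'.1 c hc, hy'.1 c hc]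
      · have := hz l.toLinearMap
        simp only [ContinuousLinearMap.coe_coe] at this
        rw [this]
        linarith [hx'.2 w hw, hy'.2 w hw]
    have hsub : ∀ c ∈ active s z, c ∈ active s x ∧ c ∈ active s y := fun c hc => by
      have h := hc.2
      rw [hz] at h
      have h1 := hFs hx c hc.1
      have h2 := hFs hy c hc.1
      exact ⟨⟨hc.1, by linarith⟩, ⟨hc.1, by linarith⟩⟩
    have heq : active s z = active s x :=
      Set.eq_of_subset_of_ncard_le (fun c hc => (hsub c hc).1) (hmin z hzF) (finite_active s x)
    exact fun c hc => (hsub c (heq ▸ hc)).2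
  · obtain ⟨t, ht, h, -⟩ := exists_add_smul_mem_solutions_of_mem_activeKer (hFs hx) hv
    exact ⟨t, ht, IsExposed.add_smul_mem hF hx hv h⟩

/-- The smallest face containing a given point of a polyhedron. -/
def minimalFace (s : Finset ((V →ₗ[ℝ] ℝ) × ℝ)) (x : V) : Set V :=
  {y ∈ solutions s | active s x ⊆ active s y}

theorem mem_minimalFace_self {s : Finset ((V →ₗ[ℝ] ℝ) × ℝ)} {x : V} (hx : x ∈ solutions s) :
    x ∈ minimalFace s x := ⟨hx, subset_rfl⟩

/-- The sum of the functionals active at `x` exposes this face: the sum is maximal exactly when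
every summand is. -/
theorem isExposed_minimalFace [TopologicalSpace V] [IsTopologicalAddGroup V]
    [ContinuousSMul ℝ V] [T2Space V] [FiniteDimensional ℝ V]
    {s : Finset ((V →ₗ[ℝ] ℝ) × ℝ)} {x : V} (hx : x ∈ solutions s) :
    IsExposed ℝ (solutions s) (minimalFace s x) := by
  classical
  intro _
  set A := (finite_active s x).toFinset
  have hA : ∀ {c}, c ∈ A ↔ c ∈ active s x := Set.Finite.mem_toFinset _
  have hsum : ∀ y, (∑ c ∈ A, c.1) y = ∑ c ∈ A, c.1 y := fun y => by simp
  refine ⟨LinearMap.toContinuousLinearMap (∑ c ∈ A, c.1), Set.ext fun y => ?_⟩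
  simp only [LinearMap.coe_toContinuousLinearMap', hsum]
  refine ⟨fun hy => ⟨hy.1, fun z hz => Finset.sum_le_sum fun c hc => ?_⟩,
    fun hy => ⟨hy.1, fun c hc => ?_⟩⟩
  · rw [(hy.2 (hA.1 hc)).2]
    exact hz c (hA.1 hc).1
  · have h := hy.2 x hx
    have hle : ∀ c ∈ A, c.1 y ≤ c.1 x := fun c hc => by
      rw [(hA.1 hc).2]
      exact hy.1 c (hA.1 hc).1
    have := (Finset.sum_eq_sum_iff_of_le hle).1 (le_antisymm (Finset.sum_le_sum hle) h) c (hA.2 hc)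
    exact ⟨hc.1, this.trans hc.2⟩

theorem tan_minimalFace {s : Finset ((V →ₗ[ℝ] ℝ) × ℝ)} {x : V} (hx : x ∈ solutions s) :
    tan (minimalFace s x) = activeKer s x := by
  refine tan_eq_activeKer (mem_minimalFace_self hx) (fun y hy => hy.2) fun v hv => ?_
  obtain ⟨t, ht, h, -⟩ := exists_add_smul_mem_solutions_of_mem_activeKer hx hv
  refine ⟨t, ht, h, fun c hc => ⟨hc.1, ?_⟩⟩
  rw [map_add, map_smul, hv c hc, smul_zero, add_zero, hc.2]

/-! ### Compact polyhedra, and directions of increase. -/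

theorem convex_solutions (s : Finset ((V →ₗ[ℝ] ℝ) × ℝ)) : Convex ℝ (solutions s) := by
  intro x hx y hy a b ha hb hab c hc
  simp only [map_add, map_smul, smul_eq_mul]
  calc a * c.1 x + b * c.1 y ≤ a * c.2 + b * c.2 :=
        add_le_add (mul_le_mul_of_nonneg_left (hx c hc) ha) (mul_le_mul_of_nonneg_left (hy c hc) hb)
    _ = c.2 := by rw [← add_mul, hab, one_mul]

theorem isClosed_solutions [TopologicalSpace V] [IsTopologicalAddGroup V] [ContinuousSMul ℝ V]
    [T2Space V] [FiniteDimensional ℝ V] (s : Finset ((V →ₗ[ℝ] ℝ) × ℝ)) :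
    IsClosed (solutions s) := by
  have : solutions s = ⋂ c ∈ s, {x | c.1 x ≤ c.2} := by
    ext x
    simp [solutions]
  rw [this]
  exact isClosed_biInter fun c _ =>
    isClosed_le (LinearMap.continuous_of_finiteDimensional c.1) continuous_const

/-- An extreme point is determined by its active set: two points with equal active sets differ by a
direction along which one can move both ways. -/
theorem finite_extremePoints_solutions (s : Finset ((V →ₗ[ℝ] ℝ) × ℝ)) :
    ((solutions s).extremePoints ℝ).Finite := by
  refine Set.Finite.of_injOn (f := active s) (t := {A | A ⊆ (s : Set ((V →ₗ[ℝ] ℝ) × ℝ))})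
    (fun x _ => active_subset s x) ?_ s.finite_toSet.finite_subsets
  intro x hx y _ hxy
  have hv : y - x ∈ activeKer s x := fun c hc => by
    rw [map_sub, hc.2, (show c ∈ active s y from hxy ▸ hc).2, sub_self]
  obtain ⟨t, ht, h1, h2⟩ := exists_add_smul_mem_solutions_of_mem_activeKer hx.1 hv
  have h := hx.2 h1 h2 ⟨1 / 2, 1 / 2, by norm_num, by norm_num, by norm_num, by module⟩
  rw [add_eq_left, smul_eq_zero, sub_eq_zero] at h
  exact (h.resolve_left ht.ne').symm

/-- A bounded polyhedron is a polytope. -/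
theorem isPolytope_solutions [FiniteDimensional ℝ V] [TopologicalSpace V]
    [IsTopologicalAddGroup V] [ContinuousSMul ℝ V] [T2Space V] [LocallyConvexSpace ℝ V]
    {s : Finset ((V →ₗ[ℝ] ℝ) × ℝ)} (h : IsCompact (solutions s)) : IsPolytope (solutions s) := by
  have hfin := finite_extremePoints_solutions s
  refine ⟨_, hfin, ?_⟩
  conv_lhs => rw [← closure_convexHull_extremePoints h (convex_solutions s)]
  exact hfin.isClosed_convexHull ℝ |>.closure_eq

/-- If `l` takes a larger value than `l x` on a polyhedron, then there is a face through `x` with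
tangent space `M` such that each vector of `M` on which `l` is positive points from `x` into the
polyhedron. -/
theorem exists_face_forall_pos {s : Finset ((V →ₗ[ℝ] ℝ) × ℝ)} {x y : V} (hx : x ∈ solutions s)
    (hy : y ∈ solutions s) {l : V →ₗ[ℝ] ℝ} (hl : l x < l y) :
    ∃ z ∈ solutions s, (∃ w ∈ activeKer s z, 0 < l w) ∧
      ∀ r ∈ activeKer s z, 0 < l r → ∃ t : ℝ, 0 < t ∧ x + t • r ∈ solutions s := by
  set K : Set V := {w | (∀ c ∈ active s x, c.1 w ≤ 0) ∧ 0 < l w}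
  have hK : (y - x) ∈ K := ⟨fun c hc => by
    rw [map_sub, hc.2]
    linarith [hy c hc.1], by rw [map_sub]; linarith⟩
  let Z : V → Set ((V →ₗ[ℝ] ℝ) × ℝ) := fun w => {c ∈ active s x | c.1 w = 0}
  -- `K` consists of the feasible directions at `x` that increase `l`; `w` lies on as many walls of
  -- the cone as possible.
  obtain ⟨w, hw, hmax⟩ : ∃ w ∈ K, ∀ u ∈ K, ¬ Z w ⊂ Z u := by
    obtain ⟨w, hw⟩ := exists_minimalFor_of_wellFoundedLT (· ∈ K)
      (fun w => (active s x \ Z w).ncard) ⟨_, hK⟩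
    refine ⟨w, hw.1, fun u hu hlt => ?_⟩
    have : (active s x \ Z u).ncard < (active s x \ Z w).ncard := by
      obtain ⟨c, hc, hcw⟩ := Set.exists_of_ssubset hlt
      refine Set.ncard_lt_ncard ((Set.ssubset_iff_of_subset
        (Set.sdiff_subset_sdiff_right hlt.1)).2 ⟨c, ⟨hc.1, hcw⟩, fun h => h.2 hc⟩)
        ((finite_active s x).subset Set.sdiff_subset)
    exact this.not_ge (hw.2 hu this.le)
  -- a direction which `w` sees as constant is a direction of lineality
  have hlin : ∀ u, (∀ c ∈ Z w, c.1 u = 0) → l u = 0 → ∀ c ∈ active s x, c.1 u = 0 := by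
    have hle : ∀ u, (∀ c ∈ Z w, c.1 u = 0) → l u = 0 → ∀ c ∈ active s x, c.1 u ≤ 0 := by
      intro u hu hlu
      by_contra! hex
      classical
      obtain ⟨c₀, hc₀, hpos⟩ := hex
      -- The cone of feasible directions is itself a polyhedron. Moving from `w` along `u` inside it
      -- reaches a new wall while `l` keeps its value, contradicting the choice of `w`.
      let s' : Finset ((V →ₗ[ℝ] ℝ) × ℝ) :=
        (finite_active s x).toFinset.image fun c => (c.1, (0 : ℝ))
      have hs' : ∀ v, v ∈ solutions s' ↔ ∀ c ∈ active s x, c.1 v ≤ 0 := fun v => by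
        refine ⟨fun h c hc => h (c.1, 0) (Finset.mem_image.2 ⟨c, by simpa using hc, rfl⟩),
          fun h d hd => ?_⟩
        obtain ⟨c, hc, rfl⟩ := Finset.mem_image.1 hd
        exact h c (by simpa using hc)
      obtain ⟨t, -, ht, d, hd, hdu, hdt⟩ := exists_add_smul_mem_solutions ((hs' w).2 hw.1)
        ⟨(c₀.1, 0), Finset.mem_image.2 ⟨c₀, by simpa using hc₀, rfl⟩, hpos⟩
      obtain ⟨c, hc, rfl⟩ := Finset.mem_image.1 hd
      rw [Set.Finite.mem_toFinset] at hc
      have hmem : w + t • u ∈ K := ⟨(hs' _).1 ht, by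
        rw [map_add, map_smul, hlu, smul_zero, add_zero]
        exact hw.2⟩
      have hsub : Z w ⊆ Z (w + t • u) := fun e he => ⟨he.1, by
        rw [map_add, map_smul, he.2, hu e he, smul_zero, add_zero]⟩
      exact hmax _ hmem ((Set.ssubset_iff_of_subset hsub).2
        ⟨c, ⟨hc, hdt⟩, fun h => hdu.ne' (hu c h)⟩)
    intro u hu hlu c hc
    refine le_antisymm (hle u hu hlu c hc) ?_
    have := hle (-u) (fun d hd => by rw [map_neg, hu d hd, neg_zero])
      (by rw [map_neg, hlu, neg_zero]) c hc
    rwa [map_neg, neg_nonpos] at this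
  obtain ⟨ε, ⟨hz, hε⟩, hslack⟩ := (((eventually_add_smul_mem_solutions hx hw.1).and
    self_mem_nhdsWithin).and (eventually_lt_of_lt s x w)).exists
  -- For small `ε`, constraints slack at `x` stay slack, and those active at `x` stay active exactly
  -- when `w` annihilates them.
  have hact : active s (x + ε • w) = Z w := by
    ext c
    constructor
    · rintro ⟨hc, hce⟩
      have hcx : c ∈ active s x := ⟨hc, by
        by_contra hne
        exact (hslack c hc (lt_of_le_of_ne (hx c hc) hne)).ne hce⟩
      refine ⟨hcx, ?_⟩
      rw [map_add, map_smul, hcx.2, add_eq_left, smul_eq_mul] at hce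
      exact (mul_eq_zero.1 hce).resolve_left (ne_of_gt hε)
    · rintro ⟨hc, hcw⟩
      exact ⟨hc.1, by rw [map_add, map_smul, hcw, smul_zero, add_zero, hc.2]⟩
  refine ⟨x + ε • w, hz, ⟨w, ?_, hw.2⟩, fun r hr hlr => ?_⟩
  · rw [mem_activeKer, hact]
    exact fun c hc => hc.2
  · rw [mem_activeKer, hact] at hr
    have hα : 0 < l r / l w := div_pos hlr hw.2
    -- Scaling `w` to the same `l`-value as `r` leaves a lineality difference, so `r` is feasible
    -- because `w` is.
    have h := hlin (r - (l r / l w) • w)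
      (fun c hc => by rw [map_sub, map_smul, hr c hc, hc.2, smul_zero, sub_zero])
      (by rw [map_sub, map_smul, smul_eq_mul, div_mul_cancel₀ _ hw.2.ne', sub_self])
    obtain ⟨t, h1, h2⟩ := ((eventually_add_smul_mem_solutions hx (v := r) fun c hc => by
      have h' := h c hc
      rw [map_sub, map_smul, smul_eq_mul, sub_eq_zero] at h'
      rw [h']
      exact mul_nonpos_of_nonneg_of_nonpos hα.le (hw.1 c hc)).and self_mem_nhdsWithin).exists
    exact ⟨t, h2, h1⟩

end General
-- From root polyhedra to submodular functions.
section Support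

variable {N : Type*} [Fintype N] [DecidableEq N]

/-- The functional `x ↦ x(S)`. -/
def sumOn (S : Finset N) : (N → ℝ) →ₗ[ℝ] ℝ := ∑ i ∈ S, LinearMap.proj i

omit [Fintype N] [DecidableEq N] in
theorem sumOn_apply (S : Finset N) (x : N → ℝ) : sumOn S x = ∑ i ∈ S, x i := by
  simp [sumOn]

/-- The vector `e_i - e_j`. -/
def root (i j : N) : N → ℝ := Pi.single i (1 : ℝ) - Pi.single j (1 : ℝ)

omit [Fintype N] in
theorem sumOn_root (S : Finset N) (i j : N) :
    sumOn S (root i j) = (if i ∈ S then 1 else 0) - (if j ∈ S then 1 else 0) := by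
  simp [sumOn_apply, root, Pi.single_apply]

theorem sumOn_univ_root (i j : N) : sumOn Finset.univ (root i j) = 0 := by
  simp [sumOn_root]

omit [Fintype N] in
theorem exists_root_of_pos {B : Set (N → ℝ)} (hB : B ⊆ roots N) {q : (N → ℝ) →ₗ[ℝ] ℝ}
    {w : N → ℝ} (hw : w ∈ Submodule.span ℝ B) (hq : 0 < q w) :
    ∃ i j, root i j ∈ Submodule.span ℝ B ∧ 0 < q (root i j) := by
  obtain ⟨r, hr, hqr⟩ : ∃ r ∈ B, q r ≠ 0 := by
    by_contra! h
    have : Submodule.span ℝ B ≤ LinearMap.ker q := Submodule.span_le.2 h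
    exact hq.ne' (this hw)
  obtain ⟨i, j, rfl⟩ := hB hr
  rcases hqr.lt_or_gt with h | h
  · have hji : root j i = -(Pi.single i (1 : ℝ) - Pi.single j (1 : ℝ)) := by simp [root]
    refine ⟨j, i, ?_, ?_⟩
    · rw [hji]
      exact neg_mem (Submodule.subset_span hr)
    · rw [hji, map_neg]
      linarith
  · exact ⟨i, j, Submodule.subset_span hr, h⟩

/-- The tangent cones of a root polyhedron are generated by roots, in dual form. -/
theorem exists_root_add_smul_mem {P : Set (N → ℝ)} (hP : P ∈ rootPolyhedra N) {x y : N → ℝ}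
    (hx : x ∈ P) (hy : y ∈ P) {q : (N → ℝ) →ₗ[ℝ] ℝ} (hq : q x < q y) :
    ∃ i j, 0 < q (root i j) ∧ ∃ t : ℝ, 0 < t ∧ x + t • root i j ∈ P := by
  obtain ⟨hpoly, hflat⟩ := hP
  obtain ⟨s, rfl⟩ := isPolyhedron_iff_exists_solutions.1 hpoly
  obtain ⟨z, hz, ⟨w, hw, hqw⟩, hpos⟩ := exists_face_forall_pos hx hy hq
  obtain ⟨B, hB, hspan⟩ := hflat _ (isExposed_minimalFace hz) ⟨z, mem_minimalFace_self hz⟩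
  rw [tan_minimalFace hz] at hspan
  rw [hspan] at hw
  obtain ⟨i, j, hmem, hij⟩ := exists_root_of_pos hB hw hqw
  exact ⟨i, j, hij, hpos _ (hspan ▸ hmem) hij⟩

/-- A maximizer of a functional on a root polyhedron maximizes all its strict upper level sets. -/
theorem sumOn_le_of_isMax {P : Set (N → ℝ)} (hP : P ∈ rootPolyhedra N) {l : (N → ℝ) →ₗ[ℝ] ℝ}
    {x : N → ℝ} (hx : x ∈ P) (hmax : ∀ y ∈ P, l y ≤ l x) {S : Finset N}
    (hS : ∀ i ∈ S, ∀ j ∉ S, 0 < l (root i j)) {y : N → ℝ} (hy : y ∈ P) :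
    sumOn S y ≤ sumOn S x := by
  by_contra! h
  obtain ⟨i, j, hij, t, ht, hmem⟩ := exists_root_add_smul_mem hP hx hy h
  have hlt : 0 < l (root i j) := by
    rw [sumOn_root] at hij
    by_cases hi : i ∈ S <;> by_cases hj : j ∈ S <;> simp [hi, hj] at hij
    · exact hS i hi j hj
    · linarith
  have := hmax _ hmem
  rw [map_add, map_smul, smul_eq_mul] at this
  linarith [mul_pos ht hlt]

-- A discrete layer-cake argument: subtracting the least positive coefficient from all positive ones
-- splits off one level set and leaves fewer positive coefficients.
omit [DecidableEq N] in
theorem sum_mul_nonpos_of_level {c d : N → ℝ} (hc : ∀ i, 0 ≤ c i)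
    (h : ∀ γ : ℝ, 0 < γ → ∑ i with γ ≤ c i, d i ≤ 0) : ∑ i, c i * d i ≤ 0 := by
  induction hn : (Finset.univ.filter fun i => 0 < c i).card using Nat.strong_induction_on
    generalizing c with
  | _ n ih =>
    rcases (Finset.univ.filter fun i => 0 < c i).eq_empty_or_nonempty with he | hne
    · refine (Finset.sum_eq_zero fun i _ => ?_).le
      have : ¬ 0 < c i := fun hi => by
        have : i ∈ Finset.univ.filter fun i => 0 < c i := by simpa using hi
        simp [he] at this
      rw [le_antisymm (not_lt.1 this) (hc i), zero_mul]
    · obtain ⟨k, hk, hmin⟩ := Finset.exists_min_image _ c hne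
      rw [Finset.mem_filter] at hk
      have hmin' : ∀ i, 0 < c i → c k ≤ c i := fun i hi => hmin i (by simpa using hi)
      set c' : N → ℝ := fun i => if 0 < c i then c i - c k else 0 with hc'
      have hnonneg : ∀ i, 0 ≤ c' i := fun i => by
        by_cases hi : 0 < c i
        · simpa [hc', hi] using hmin' i hi
        · simp [hc', hi]
      have hlevel : ∀ γ : ℝ, 0 < γ → ∑ i with γ ≤ c' i, d i ≤ 0 := fun γ hγ => by
        have : (Finset.univ.filter fun i => γ ≤ c' i) =
            Finset.univ.filter fun i => γ + c k ≤ c i := by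
          ext i
          simp only [Finset.mem_filter, Finset.mem_univ, true_and]
          by_cases hi : 0 < c i
          · simp only [hc', hi, if_true]
            constructor <;> intro <;> linarith
          · simp only [hc', hi, if_false]
            constructor <;> intro <;> linarith [hk.2]
        rw [this]
        exact h _ (add_pos hγ hk.2)
      have hlt : (Finset.univ.filter fun i => 0 < c' i).card < n := by
        rw [← hn]
        refine Finset.card_lt_card ((Finset.ssubset_iff_of_subset fun i hi => ?_).2
          ⟨k, by simpa using hk.2, by simp [hc']⟩)
        simp only [Finset.mem_filter, Finset.mem_univ, true_and] at hi ⊢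
        by_contra hi'
        simp [hc', hi'] at hi
      have hS : ∑ i with 0 < c i, d i ≤ 0 := by
        have : (Finset.univ.filter fun i => 0 < c i) = Finset.univ.filter fun i => c k ≤ c i := by
          ext i
          simp only [Finset.mem_filter, Finset.mem_univ, true_and]
          exact ⟨hmin' i, hk.2.trans_le⟩
        rw [this]
        exact h _ hk.2
      have hsplit : ∑ i, c i * d i = ∑ i, c' i * d i + c k * ∑ i with 0 < c i, d i := by
        rw [Finset.mul_sum, Finset.sum_filter, ← Finset.sum_add_distrib]
        refine Finset.sum_congr rfl fun i _ => ?_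
        by_cases hi : 0 < c i
        · simp only [hc', hi, if_true]
          ring
        · simp [hc', le_antisymm (not_lt.1 hi) (hc i)]
      rw [hsplit]
      linarith [ih _ hlt hnonneg hlevel rfl, mul_nonpos_of_nonneg_of_nonpos hk.2.le hS]

/-- Comparison of the values of a functional by means of its upper level sets. -/
theorem apply_le_of_level {l : (N → ℝ) →ₗ[ℝ] ℝ} {x z : N → ℝ}
    (huniv : sumOn Finset.univ x = sumOn Finset.univ z)
    (h : ∀ S : Finset N, (∀ i ∈ S, ∀ j ∉ S, 0 < l (root i j)) → sumOn S x ≤ sumOn S z) :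
    l x ≤ l z := by
  set c : N → ℝ := fun i => l (Pi.single i 1) with hcdef
  have hl : ∀ y, l y = ∑ i, c i * y i := fun y => by
    conv_lhs => rw [← Finset.univ_sum_single y, map_sum]
    refine Finset.sum_congr rfl fun i _ => ?_
    have : Pi.single i (y i) = y i • (Pi.single i 1 : N → ℝ) := by
      rw [← Pi.single_smul, smul_eq_mul, mul_one]
    simp [this, hcdef, mul_comm]
  have hroot : ∀ i j, l (root i j) = c i - c j := fun i j => by rw [root, map_sub]
  -- Shifting all coefficients by `M` makes them non-negative; since x(N) = z(N), the shift does not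
  -- affect the comparison.
  set M := ∑ i, |c i|
  have hM : ∀ i, 0 ≤ c i + M := fun i => by
    have : |c i| ≤ M := Finset.single_le_sum (f := fun i => |c i|)
      (fun _ _ => abs_nonneg _) (Finset.mem_univ i)
    linarith [neg_abs_le (c i)]
  have key := sum_mul_nonpos_of_level (c := fun i => c i + M) (d := fun i => x i - z i) hM
    fun γ _ => by
      have := h (Finset.univ.filter fun i => γ ≤ c i + M) fun i hi j hj => by
        simp only [Finset.mem_filter, Finset.mem_univ, true_and, not_le] at hi hj
        rw [hroot]
        linarith
      rw [sumOn_apply, sumOn_apply] at this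
      rw [Finset.sum_sub_distrib]
      linarith
  simp only [sumOn_apply] at huniv
  simp only [add_mul, mul_sub, Finset.sum_add_distrib, Finset.sum_sub_distrib,
    ← Finset.mul_sum, huniv] at key
  rw [hl, hl]
  linarith

/-- `b` is the restriction of the support function of `P` to the indicator functions. -/
def IsSupport (b : Finset N → WithTop ℝ) (P : Set (N → ℝ)) : Prop :=
  ∀ S, (∀ y ∈ P, ((sumOn S y : ℝ) : WithTop ℝ) ≤ b S) ∧
    ∀ M : ℝ, (∀ y ∈ P, sumOn S y ≤ M) → ∃ x ∈ P, b S = (sumOn S x : ℝ)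

omit [Fintype N] [DecidableEq N] in
theorem exists_isSupport {P : Set (N → ℝ)} (hP : IsPolyhedron P) (hne : P.Nonempty) :
    ∃ b, IsSupport b P := by
  obtain ⟨s, rfl⟩ := isPolyhedron_iff_exists_solutions.1 hP
  suffices h : ∀ S : Finset N, ∃ a : WithTop ℝ,
      (∀ y ∈ solutions s, ((sumOn S y : ℝ) : WithTop ℝ) ≤ a) ∧
      ∀ M : ℝ, (∀ y ∈ solutions s, sumOn S y ≤ M) → ∃ x ∈ solutions s, a = (sumOn S x : ℝ) by
    choose b hb using h
    exact ⟨b, hb⟩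
  intro S
  by_cases h : ∃ M : ℝ, ∀ y ∈ solutions s, sumOn S y ≤ M
  · obtain ⟨M, hM⟩ := h
    obtain ⟨x, hx, hmax⟩ := exists_isMaxOn_solutions hM hne
    exact ⟨(sumOn S x : ℝ), fun y hy => WithTop.coe_le_coe.2 (hmax y hy),
      fun _ _ => ⟨x, hx, rfl⟩⟩
  · exact ⟨⊤, fun _ _ => le_top, fun M hM => absurd ⟨M, hM⟩ h⟩

namespace IsSupport

variable {b : Finset N → WithTop ℝ} {P : Set (N → ℝ)}

omit [Fintype N] [DecidableEq N] in
theorem exists_eq (hb : IsSupport b P) {S : Finset N} (h : b S ≠ ⊤) :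
    ∃ x ∈ P, b S = (sumOn S x : ℝ) ∧ ∀ y ∈ P, sumOn S y ≤ sumOn S x := by
  obtain ⟨M, hM⟩ := WithTop.ne_top_iff_exists.1 h
  obtain ⟨x, hx, hbx⟩ := (hb S).2 M fun y hy => by
    have := (hb S).1 y hy
    rwa [← hM, WithTop.coe_le_coe] at this
  exact ⟨x, hx, hbx, fun y hy => WithTop.coe_le_coe.1 (hbx ▸ (hb S).1 y hy)⟩

omit [Fintype N] [DecidableEq N] in
theorem eq_of_isMax (hb : IsSupport b P) {S : Finset N} {x : N → ℝ} (hx : x ∈ P)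
    (hmax : ∀ y ∈ P, sumOn S y ≤ sumOn S x) : b S = (sumOn S x : ℝ) := by
  obtain ⟨z, hz, h⟩ := (hb S).2 _ hmax
  refine le_antisymm ?_ ((hb S).1 x hx)
  rw [h]
  exact WithTop.coe_le_coe.2 (hmax z hz)

omit [Fintype N] in
theorem sumOn_union_add_sumOn_inter (S T : Finset N) (x : N → ℝ) :
    sumOn (S ∪ T) x + sumOn (S ∩ T) x = sumOn S x + sumOn T x := by
  simp only [sumOn_apply, Finset.sum_union_inter]

/-- Both S ∪ T and S ∩ T are strict upper level sets of 1_S + 1_T, so a single maximizer of that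
functional attains b at both of them. -/
theorem isSubmodular (hb : IsSupport b P) (hP : P ∈ rootPolyhedra N) : IsSubmodular b := by
  intro S T
  by_cases hS : b S = ⊤
  · simp [hS]
  by_cases hT : b T = ⊤
  · simp [hT]
  obtain ⟨u, hu, hbu, hmu⟩ := hb.exists_eq hS
  obtain ⟨v, hv, hbv, hmv⟩ := hb.exists_eq hT
  obtain ⟨s, hs⟩ := isPolyhedron_iff_exists_solutions.1 hP.1
  obtain ⟨z, hz, hmax⟩ := exists_isMaxOn_solutions (s := s) (l := sumOn (S ∪ T) + sumOn (S ∩ T))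
    (M := sumOn S u + sumOn T v) (fun y hy => by
      rw [LinearMap.add_apply, sumOn_union_add_sumOn_inter]
      exact add_le_add (hmu y (hs ▸ hy)) (hmv y (hs ▸ hy))) (hs ▸ ⟨u, hu⟩)
  rw [← hs] at hz hmax
  have h1 : b (S ∪ T) = (sumOn (S ∪ T) z : ℝ) := by
    refine hb.eq_of_isMax hz fun y hy => sumOn_le_of_isMax hP hz hmax (fun i hi j hj => ?_) hy
    have hj' : j ∉ S ∩ T := fun h => hj (Finset.mem_union_left _ (Finset.mem_inter.1 h).1)
    rw [LinearMap.add_apply, sumOn_root, sumOn_root, if_pos hi, if_neg hj, if_neg hj']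
    split_ifs <;> norm_num
  have h2 : b (S ∩ T) = (sumOn (S ∩ T) z : ℝ) := by
    refine hb.eq_of_isMax hz fun y hy => sumOn_le_of_isMax hP hz hmax (fun i hi j hj => ?_) hy
    have hi' : i ∈ S ∪ T := Finset.mem_union_left _ (Finset.mem_inter.1 hi).1
    rw [LinearMap.add_apply, sumOn_root, sumOn_root, if_pos hi, if_neg hj, if_pos hi']
    split_ifs <;> norm_num
  rw [h1, h2, hbu, hbv, ← WithTop.coe_add, ← WithTop.coe_add, WithTop.coe_le_coe,
    sumOn_union_add_sumOn_inter]
  exact add_le_add (hmu z hz) (hmv z hz)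

end IsSupport

omit [DecidableEq N] in
theorem mem_base_iff {b : Finset N → WithTop ℝ} {x : N → ℝ} :
    x ∈ base b ↔ (∀ S, ((sumOn S x : ℝ) : WithTop ℝ) ≤ b S) ∧
      ((sumOn Finset.univ x : ℝ) : WithTop ℝ) = b Finset.univ := by
  simp only [base, sumOn_apply, Set.mem_ofPred_eq]

/-- Total mass vanishes on roots, so no root can increase it. -/
theorem sumOn_univ_eq_of_mem {P : Set (N → ℝ)} (hP : P ∈ rootPolyhedra N) {x y : N → ℝ}
    (hx : x ∈ P) (hy : y ∈ P) : sumOn Finset.univ x = sumOn Finset.univ y := by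
  by_contra h
  rcases lt_or_gt_of_ne h with h | h
  · obtain ⟨i, j, hij, -⟩ := exists_root_add_smul_mem hP hx hy h
    exact hij.ne' (sumOn_univ_root i j)
  · obtain ⟨i, j, hij, -⟩ := exists_root_add_smul_mem hP hy hx h
    exact hij.ne' (sumOn_univ_root i j)

theorem IsSupport.eq_base {b : Finset N → WithTop ℝ} {P : Set (N → ℝ)} (hb : IsSupport b P)
    (hP : P ∈ rootPolyhedra N) (hne : P.Nonempty) : P = base b := by
  have huniv : ∀ x ∈ P, b Finset.univ = (sumOn Finset.univ x : ℝ) := fun x hx =>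
    hb.eq_of_isMax hx fun y hy => (sumOn_univ_eq_of_mem hP hy hx).le
  ext x
  rw [mem_base_iff]
  refine ⟨fun hx => ⟨fun S => (hb S).1 x hx, (huniv x hx).symm⟩, fun hx => ?_⟩
  obtain ⟨s, hs⟩ := isPolyhedron_iff_exists_solutions.1 hP.1
  rw [hs]
  intro c hc
  -- The maximizer `z` attains b on every strict upper level set of the inequality, so `x` is
  -- dominated by `z` on these sets and hence in the value of `c.1`.
  obtain ⟨z, hz, hmax⟩ := exists_isMaxOn_solutions (s := s) (l := c.1) (M := c.2)
    (fun y hy => hy c hc) (hs ▸ hne)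
  refine le_trans (apply_le_of_level ?_ fun S hS => ?_) (hz c hc)
  · exact WithTop.coe_injective (hx.2.trans (huniv z (hs ▸ hz)))
  · rw [← hs] at hz hmax
    have := hx.1 S
    rwa [hb.eq_of_isMax hz fun y hy => sumOn_le_of_isMax hP hz hmax hS hy,
      WithTop.coe_le_coe] at this

end Support
-- From submodular functions to root polyhedra.
section Base

variable {N : Type*} [Fintype N] [DecidableEq N]

open Classical in
/-- The inequalities defining a base polyhedron. -/
noncomputable def baseConstraints (b : Finset N → WithTop ℝ) :
    Finset (((N → ℝ) →ₗ[ℝ] ℝ) × ℝ) :=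
  -- The default 0 would be wrong for b(N) = +∞, a case treated separately since then B(b) is empty;
  -- elsewhere infinite values are filtered out.
  insert (-sumOn Finset.univ, -(b Finset.univ).untopD 0)
    ((Finset.univ.filter fun S => b S ≠ ⊤).image fun S => (sumOn S, (b S).untopD 0))

omit [DecidableEq N] in
theorem mem_baseConstraints {b : Finset N → WithTop ℝ} {c : ((N → ℝ) →ₗ[ℝ] ℝ) × ℝ} :
    c ∈ baseConstraints b ↔ c = (-sumOn Finset.univ, -(b Finset.univ).untopD 0) ∨
      ∃ S, b S ≠ ⊤ ∧ c = (sumOn S, (b S).untopD 0) := by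
  simp [baseConstraints, eq_comm]

omit [DecidableEq N] in
theorem solutions_baseConstraints {b : Finset N → WithTop ℝ} (h : b Finset.univ ≠ ⊤) :
    solutions (baseConstraints b) = base b := by
  ext x
  rw [mem_base_iff]
  obtain ⟨β, hβ⟩ := WithTop.ne_top_iff_exists.1 h
  constructor
  · intro hx
    have hle : ∀ S, ((sumOn S x : ℝ) : WithTop ℝ) ≤ b S := fun S => by
      by_cases hS : b S = ⊤
      · simp [hS]
      · obtain ⟨a, ha⟩ := WithTop.ne_top_iff_exists.1 hS
        have := hx _ (mem_baseConstraints.2 (Or.inr ⟨S, hS, rfl⟩))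
        rw [← ha] at this ⊢
        exact WithTop.coe_le_coe.2 this
    refine ⟨hle, le_antisymm (hle _) ?_⟩
    have := hx _ (mem_baseConstraints.2 (Or.inl rfl))
    rw [← hβ] at this ⊢
    simp only [LinearMap.neg_apply, WithTop.untopD_coe] at this
    exact WithTop.coe_le_coe.2 (by linarith)
  · rintro ⟨hle, heq⟩ c hc
    rcases mem_baseConstraints.1 hc with rfl | ⟨S, hS, rfl⟩
    · simp [← heq]
    · obtain ⟨a, ha⟩ := WithTop.ne_top_iff_exists.1 hS
      have := hle S
      rw [← ha, WithTop.coe_le_coe] at this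
      simpa [← ha] using this

omit [DecidableEq N] in
theorem base_eq_empty_of_top {b : Finset N → WithTop ℝ} (h : b Finset.univ = ⊤) :
    base b = ∅ := by
  ext x
  simp [mem_base_iff, h]

/-- The sets `S` for which `x(S) = b(S)`, together with the empty set. -/
def tight (b : Finset N → WithTop ℝ) (x : N → ℝ) : Set (Finset N) :=
  {S | S = ∅ ∨ ((sumOn S x : ℝ) : WithTop ℝ) = b S}

/-- Modularity of x squeezes the submodular inequality into equality. The empty set is admitted
separately because b(∅) may be positive. -/
theorem union_inter_mem_tight {b : Finset N → WithTop ℝ} (hb : IsSubmodular b) {x : N → ℝ}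
    (hx : x ∈ base b) {S T : Finset N} (hS : S ∈ tight b x) (hT : T ∈ tight b x) :
    S ∪ T ∈ tight b x ∧ S ∩ T ∈ tight b x := by
  rcases hS with rfl | hS
  · simpa [tight] using hT
  rcases hT with rfl | hT
  · simpa [tight] using Or.inr hS
  have hle := (mem_base_iff.1 hx).1
  have h := hb S T
  rw [← hS, ← hT, ← WithTop.coe_add, ← IsSupport.sumOn_union_add_sumOn_inter] at h
  have h1 := hle (S ∪ T)
  have h2 := hle (S ∩ T)
  have htop : b (S ∪ T) + b (S ∩ T) ≠ ⊤ := ne_top_of_le_ne_top WithTop.coe_ne_top h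
  rw [WithTop.add_ne_top] at htop
  obtain ⟨u, hu⟩ := WithTop.ne_top_iff_exists.1 htop.1
  obtain ⟨v, hv⟩ := WithTop.ne_top_iff_exists.1 htop.2
  rw [← hu] at h h1
  rw [← hv] at h h2
  rw [← WithTop.coe_add] at h
  rw [WithTop.coe_le_coe] at h h1 h2
  refine ⟨Or.inr ?_, Or.inr ?_⟩
  · rw [← hu, WithTop.coe_inj]
    linarith
  · rw [← hv, WithTop.coe_inj]
    linarith

omit [DecidableEq N] in
theorem univ_mem_tight {b : Finset N → WithTop ℝ} {x : N → ℝ} (hx : x ∈ base b) :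
    Finset.univ ∈ tight b x :=
  Or.inr (mem_base_iff.1 hx).2

omit [DecidableEq N] in
theorem mem_activeKer_baseConstraints {b : Finset N → WithTop ℝ} {x v : N → ℝ}
    (hx : x ∈ base b) :
    v ∈ activeKer (baseConstraints b) x ↔ ∀ S ∈ tight b x, sumOn S v = 0 := by
  rw [mem_activeKer]
  constructor
  · rintro h S (rfl | hS)
    · simp [sumOn_apply]
    · exact h (sumOn S, (b S).untopD 0)
        ⟨mem_baseConstraints.2 (Or.inr ⟨S, by simp [← hS], rfl⟩), by simp [← hS]⟩
  · rintro h c ⟨hc, hcx⟩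
    rcases mem_baseConstraints.1 hc with rfl | ⟨S, hS, rfl⟩
    · simp [h _ (univ_mem_tight hx)]
    · refine h S (Or.inr ?_)
      obtain ⟨a, ha⟩ := WithTop.ne_top_iff_exists.1 hS
      simp only [← ha, WithTop.untopD_coe] at hcx
      rw [← ha, hcx]

/-- In a lattice of sets the class of points not separated from `i` is a difference of two
members. -/
theorem exists_sdiff_eq_class {D : Set (Finset N)} (h0 : ∅ ∈ D) (h1 : Finset.univ ∈ D)
    (hD : ∀ S ∈ D, ∀ T ∈ D, S ∪ T ∈ D ∧ S ∩ T ∈ D) (i : N) :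
    ∃ A ∈ D, ∃ B ∈ D, B ⊆ A ∧ ∀ j, j ∈ A \ B ↔ ∀ S ∈ D, i ∈ S ↔ j ∈ S := by
  classical
  -- `A` is the least member containing `i`, and `C` the greatest member missing `i`.
  set A := (Finset.univ.filter fun S => S ∈ D ∧ i ∈ S).inf id with hAdef
  set C := (Finset.univ.filter fun S => S ∈ D ∧ i ∉ S).sup id with hCdef
  have hA : A ∈ D := Finset.inf_mem D h1 (fun S hS T hT => (hD S hS T hT).2) _ _ fun S hS => by
    simpa using (Finset.mem_filter.1 hS).2.1
  have hC : C ∈ D := Finset.sup_mem D h0 (fun S hS T hT => (hD S hS T hT).1) _ _ fun S hS => by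
    simpa using (Finset.mem_filter.1 hS).2.1
  have hmemA : ∀ j, j ∈ A ↔ ∀ S ∈ D, i ∈ S → j ∈ S := fun j => by
    simp [hAdef, Finset.mem_inf]
  have hmemC : ∀ j, j ∈ C ↔ ∃ S ∈ D, i ∉ S ∧ j ∈ S := fun j => by
    simp [hCdef, Finset.mem_sup, and_assoc]
  refine ⟨A, hA, A ∩ C, (hD A hA C hC).2, Finset.inter_subset_left, fun j => ?_⟩
  rw [Finset.mem_sdiff, Finset.mem_inter, not_and, hmemA, hmemC]
  constructor
  · rintro ⟨h, h'⟩ S hS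
    refine ⟨h S hS, fun hj => ?_⟩
    by_contra hi
    exact h' h ⟨S, hS, hi, hj⟩
  · intro h
    refine ⟨fun S hS => (h S hS).1, fun _ => ?_⟩
    rintro ⟨S, hS, hi, hj⟩
    exact hi ((h S hS).2 hj)

omit [Fintype N] in
theorem sumOn_sdiff {A B : Finset N} (h : B ⊆ A) (x : N → ℝ) :
    sumOn (A \ B) x = sumOn A x - sumOn B x := by
  rw [sumOn_apply, sumOn_apply, sumOn_apply, Finset.sum_sdiff_eq_sub h]

omit [Fintype N] in
theorem sumOn_root_eq_zero {S : Finset N} {i j : N} : sumOn S (root i j) = 0 ↔ (i ∈ S ↔ j ∈ S) := by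
  rw [sumOn_root]
  by_cases hi : i ∈ S <;> by_cases hj : j ∈ S <;> simp [hi, hj]

/-- The vectors vanishing on a lattice of sets are spanned by roots. -/
theorem mem_span_roots_of_lattice {D : Set (Finset N)} (h0 : ∅ ∈ D) (h1 : Finset.univ ∈ D)
    (hD : ∀ S ∈ D, ∀ T ∈ D, S ∪ T ∈ D ∧ S ∩ T ∈ D) {v : N → ℝ} (hv : ∀ S ∈ D, sumOn S v = 0) :
    v ∈ Submodule.span ℝ {r | r ∈ roots N ∧ ∀ S ∈ D, sumOn S r = 0} := by
  classical
  let st : Setoid N :=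
    { r := fun i j => ∀ S ∈ D, i ∈ S ↔ j ∈ S
      iseqv := ⟨fun _ _ _ => Iff.rfl, fun h S hS => (h S hS).symm,
        fun h h' S hS => (h S hS).trans (h' S hS)⟩ }
  let rep : N → N := fun i => (Quotient.mk st i).out
  have hrep : ∀ i, ∀ S ∈ D, rep i ∈ S ↔ i ∈ S := fun i =>
    (Quotient.exact (s := st) (Quotient.out_eq (Quotient.mk st i)) : st.r (rep i) i)
  -- Each class is a difference of nested members of `D`, so `v` sums to zero over it. Subtracting
  -- this vanishing sum from `v` turns each e_i into a root.
  have hzero : ∑ i, v i • (Pi.single (rep i) 1 : N → ℝ) = 0 := by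
    ext k
    rw [Finset.sum_apply, Pi.zero_apply]
    simp only [Pi.smul_apply, Pi.single_apply, smul_eq_mul, mul_ite, mul_one, mul_zero]
    rw [← Finset.sum_filter]
    by_cases hk : rep k = k
    · obtain ⟨A, hA, B, hB, hBA, hcl⟩ := exists_sdiff_eq_class h0 h1 hD k
      have : (Finset.univ.filter fun i => k = rep i) = A \ B := by
        ext i
        rw [hcl, Finset.mem_filter]
        constructor
        · rintro ⟨-, h⟩ S hS
          rw [h]
          exact hrep i S hS
        · intro h
          refine ⟨Finset.mem_univ _, ?_⟩
          rw [← hk]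
          exact congrArg Quotient.out (Quotient.sound (s := st) h)
      rw [this, ← sumOn_apply, sumOn_sdiff hBA, hv A hA, hv B hB, sub_zero]
    · have : (Finset.univ.filter fun i => k = rep i) = ∅ := by
        refine Finset.filter_eq_empty_iff.2 fun i _ h => hk ?_
        rw [h]
        exact congrArg Quotient.out (Quotient.out_eq (Quotient.mk st i))
      rw [this, Finset.sum_empty]
  have hsum : v = ∑ i, v i • root i (rep i) := by
    simp only [root, smul_sub, Finset.sum_sub_distrib, hzero, sub_zero]
    conv_lhs => rw [← Finset.univ_sum_single v]
    refine Finset.sum_congr rfl fun i _ => ?_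
    rw [← Pi.single_smul, smul_eq_mul, mul_one]
  rw [hsum]
  exact Submodule.sum_mem _ fun i _ => Submodule.smul_mem _ _ (Submodule.subset_span
    ⟨⟨i, rep i, rfl⟩, fun S hS => sumOn_root_eq_zero.2 (hrep i S hS).symm⟩)

omit [DecidableEq N] in
theorem isPolyhedron_base (b : Finset N → WithTop ℝ) : IsPolyhedron (base b) := by
  by_cases h : b Finset.univ = ⊤
  · refine ⟨{(0, -1)}, Set.finite_singleton _, ?_⟩
    rw [base_eq_empty_of_top h]
    ext x
    simp
  · exact isPolyhedron_iff_exists_solutions.2 ⟨_, (solutions_baseConstraints h).symm⟩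

omit [DecidableEq N] in
theorem base_ne_top {b : Finset N → WithTop ℝ} {x : N → ℝ} (hx : x ∈ base b) :
    b Finset.univ ≠ ⊤ := fun h => by
  rw [base_eq_empty_of_top h] at hx
  exact hx

/-- The tangent space of a face consists of the vectors vanishing on the lattice of sets tight at a
suitable point of it. -/
theorem base_mem_rootPolyhedra {b : Finset N → WithTop ℝ} (hb : IsSubmodular b) :
    base b ∈ rootPolyhedra N := by
  refine ⟨isPolyhedron_base b, fun F hF hne => ?_⟩
  obtain ⟨x₀, hx₀⟩ := hne
  have htop := base_ne_top (hF.subset hx₀)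
  have hF' := hF
  rw [← solutions_baseConstraints htop] at hF'
  obtain ⟨x, hxF, htan⟩ := IsExposed.exists_tan_eq_activeKer hF' ⟨x₀, hx₀⟩
  have hx : x ∈ base b := hF.subset hxF
  refine ⟨{r | r ∈ roots N ∧ ∀ S ∈ tight b x, sumOn S r = 0}, fun r hr => hr.1, ?_⟩
  rw [htan]
  refine le_antisymm (fun v hv => ?_) (Submodule.span_le.2 fun r hr => ?_)
  · exact mem_span_roots_of_lattice (Or.inl rfl) (univ_mem_tight hx)
      (fun S hS T hT => union_inter_mem_tight hb hx hS hT)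
      ((mem_activeKer_baseConstraints hx).1 hv)
  · exact (mem_activeKer_baseConstraints hx).2 hr.2

/-! ### Integer points in faces, and boundedness. -/

/-- Every non-empty face of the base polyhedron of an integer submodular function contains an
integer point. -/
theorem exists_integer_mem_of_isExposed_base {b : Finset N → WithTop ℝ} (hb : IsSubmodular b)
    (hint : ∀ S, b S ≠ ⊤ → ∃ z : ℤ, b S = ((z : ℝ) : WithTop ℝ)) {F : Set (N → ℝ)}
    (hF : IsExposed ℝ (base b) F) (hne : F.Nonempty) :
    ∃ z : N → ℤ, (fun i => (z i : ℝ)) ∈ F := by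
  classical
  obtain ⟨x, hx⟩ := hne
  -- The measure of descent: fractional coordinates plus sets that are not tight.
  let bad : (N → ℝ) → ℕ := fun x =>
    (Finset.univ.filter fun i => x i ∉ Set.range ((↑) : ℤ → ℝ)).card +
      (Finset.univ.filter fun S => S ∉ tight b x).card
  induction hn : bad x using Nat.strong_induction_on generalizing x with
  | _ n ih =>
    by_cases hall : ∀ i, x i ∈ Set.range ((↑) : ℤ → ℝ)
    · choose z hz using hall
      exact ⟨z, by rwa [show (fun i => (z i : ℝ)) = x from funext hz]⟩
    push Not at hall
    obtain ⟨i, hi⟩ := hall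
    have hxb : x ∈ base b := hF.subset hx
    have htop := base_ne_top hxb
    have hxs : x ∈ solutions (baseConstraints b) := by rwa [solutions_baseConstraints htop]
    have htight : ∀ S ∈ tight b x, sumOn S x ∈ (Int.castAddHom ℝ).range := by
      rintro S (rfl | hS)
      · rw [sumOn_apply, Finset.sum_empty]
        exact zero_mem _
      · obtain ⟨z, hz⟩ := hint S (by simp [← hS])
        exact ⟨z, (WithTop.coe_injective (hS.trans hz)).symm⟩
    obtain ⟨A, hA, B, hB, hBA, hcl⟩ := exists_sdiff_eq_class (D := tight b x) (Or.inl rfl)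
      (univ_mem_tight hxb) (fun S hS T hT => union_inter_mem_tight hb hxb hS hT) i
    -- The class of `i` has integer mass, so it cannot contain just one fractional coordinate.
    obtain ⟨j, hjcl, hji, hj⟩ : ∃ j ∈ A \ B, j ≠ i ∧ x j ∉ Set.range ((↑) : ℤ → ℝ) := by
      by_contra! h
      have hiAB : i ∈ A \ B := (hcl i).2 fun _ _ => Iff.rfl
      have h1 : sumOn (A \ B) x ∈ (Int.castAddHom ℝ).range := by
        rw [sumOn_sdiff hBA]
        exact sub_mem (htight A hA) (htight B hB)
      have h2 : ∑ k ∈ (A \ B).erase i, x k ∈ (Int.castAddHom ℝ).range :=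
        sum_mem fun k hk => h k (Finset.mem_of_mem_erase hk) (Finset.ne_of_mem_erase hk)
      have h3 : x i = sumOn (A \ B) x - ∑ k ∈ (A \ B).erase i, x k := by
        rw [sumOn_apply, ← Finset.add_sum_erase _ _ hiAB, add_sub_cancel_right]
      exact hi (h3 ▸ sub_mem h1 h2)
    have hsep := (hcl j).1 hjcl
    have hker : root i j ∈ activeKer (baseConstraints b) x :=
      (mem_activeKer_baseConstraints hxb).2 fun S hS => sumOn_root_eq_zero.2 (hsep S hS)
    have hri : root i j i = 1 := by simp [root, hji.symm]
    have hrj : root i j j = -1 := by simp [root, hji]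
    have hrk : ∀ k, k ≠ i → k ≠ j → root i j k = 0 := fun k h h' => by
      simp [root, h, h']
    -- The two extra constraints stop the motion along e_i - e_j when either coordinate reaches an
    -- integer; otherwise it stops because a new set becomes tight.
    let s : Finset (((N → ℝ) →ₗ[ℝ] ℝ) × ℝ) :=
      insert (LinearMap.proj i, (⌈x i⌉ : ℝ)) (insert (-LinearMap.proj j, -(⌊x j⌋ : ℝ))
        (baseConstraints b))
    have hxs' : x ∈ solutions s := by
      intro c hc
      simp only [s, Finset.mem_insert] at hc
      rcases hc with rfl | rfl | hc
      · exact Int.le_ceil _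
      · exact neg_le_neg (Int.floor_le _)
      · exact hxs c hc
    obtain ⟨t, -, hy, c, hc, hcpos, hcy⟩ := exists_add_smul_mem_solutions (v := root i j) hxs'
      ⟨_, Finset.mem_insert_self _ _, by simp [hri]⟩
    set y := x + t • root i j with hydef
    have hys : y ∈ solutions (baseConstraints b) := fun d hd =>
      hy d (Finset.mem_insert_of_mem (Finset.mem_insert_of_mem hd))
    rw [← solutions_baseConstraints htop] at hF
    have hyF : y ∈ F := IsExposed.add_smul_mem hF hx hker hys
    have hyk : ∀ k, k ≠ i → k ≠ j → y k = x k := fun k h h' => by simp [hydef, hrk k h h']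
    have hsub1 : (Finset.univ.filter fun k => y k ∉ Set.range ((↑) : ℤ → ℝ)) ⊆
        Finset.univ.filter fun k => x k ∉ Set.range ((↑) : ℤ → ℝ) := fun k hk => by
      rw [Finset.mem_filter] at hk ⊢
      refine ⟨hk.1, ?_⟩
      by_cases h : k = i
      · exact h ▸ hi
      by_cases h' : k = j
      · exact h' ▸ hj
      exact hyk k h h' ▸ hk.2
    have hsub2 : (Finset.univ.filter fun S => S ∉ tight b y) ⊆
        Finset.univ.filter fun S => S ∉ tight b x := fun S hS => by
      rw [Finset.mem_filter] at hS ⊢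
      refine ⟨hS.1, fun h => hS.2 (h.imp id fun h' => ?_)⟩
      rw [← h', hydef, map_add, map_smul, sumOn_root_eq_zero.2 (hsep S h), smul_zero, add_zero]
    have hlt : bad y < n := by
      rw [← hn]
      have of_int : ∀ k, x k ∉ Set.range ((↑) : ℤ → ℝ) → y k ∈ Set.range ((↑) : ℤ → ℝ) →
          bad y < bad x := fun k hxk hyk =>
        add_lt_add_of_lt_of_le (Finset.card_lt_card ((Finset.ssubset_iff_of_subset hsub1).2
          ⟨k, by simpa using hxk, by simpa using hyk⟩)) (Finset.card_le_card hsub2)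
      simp only [s, Finset.mem_insert] at hc
      rcases hc with rfl | rfl | hc
      · exact of_int i hi ⟨_, hcy.symm⟩
      · exact of_int j hj ⟨_, (neg_injective hcy).symm⟩
      rcases mem_baseConstraints.1 hc with rfl | ⟨S, hS, rfl⟩
      · simp [sumOn_univ_root] at hcpos
      · refine add_lt_add_of_le_of_lt (Finset.card_le_card hsub1)
          (Finset.card_lt_card ((Finset.ssubset_iff_of_subset hsub2).2 ⟨S, ?_, ?_⟩))
        · refine Finset.mem_filter.2 ⟨Finset.mem_univ _, fun h => hcpos.ne' ?_⟩
          exact sumOn_root_eq_zero.2 (hsep S h)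
        · refine fun h => (Finset.mem_filter.1 h).2 (Or.inr ?_)
          rw [show sumOn S y = (b S).untopD 0 from hcy]
          obtain ⟨a, ha⟩ := WithTop.ne_top_iff_exists.1 hS
          simp [← ha]
    rw [solutions_baseConstraints htop] at hF
    exact ih _ hlt y hyF rfl

/-- The base polyhedron of a finite function is a polytope. -/
theorem isPolytope_base (b : Finset N → ℝ) : IsPolytope (base fun S => (b S : WithTop ℝ)) := by
  have h : (fun S => (b S : WithTop ℝ)) Finset.univ ≠ ⊤ := WithTop.coe_ne_top
  rw [← solutions_baseConstraints h]
  refine isPolytope_solutions (Metric.isCompact_of_isClosed_isBounded (isClosed_solutions _) ?_)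
  rw [solutions_baseConstraints h]
  -- The lower bound comes from x(i) = x(N) - x(N \ i).
  refine (Bornology.IsBounded.pi fun i => Metric.isBounded_Icc
    (b Finset.univ - b (Finset.univ.erase i)) (b {i})).subset fun x hx i _ => ?_
  have hx' := mem_base_iff.1 hx
  simp only [WithTop.coe_le_coe, WithTop.coe_inj, sumOn_apply] at hx'
  have h1 := hx'.1 {i}
  have h2 := hx'.1 (Finset.univ.erase i)
  rw [← hx'.2, ← Finset.add_sum_erase _ _ (Finset.mem_univ i)]
  rw [Finset.sum_singleton] at h1
  exact ⟨by linarith, h1⟩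

end Base
-- Integrality, finiteness, and the four equalities.
section Main

variable {N : Type*} [Fintype N] [DecidableEq N]

theorem isRationalPolyhedron_base {b : Finset N → WithTop ℝ}
    (hint : ∀ S, b S ≠ ⊤ → ∃ z : ℤ, b S = ((z : ℝ) : WithTop ℝ)) :
    IsRationalPolyhedron (base b) := by
  by_cases h : b Finset.univ = ⊤
  · refine ⟨{(0, -1)}, Set.finite_singleton _, ?_⟩
    rw [base_eq_empty_of_top h]
    ext x
    simp
  have hz : ∀ S, ∃ z : ℤ, b S ≠ ⊤ → b S = ((z : ℝ) : WithTop ℝ) := fun S => by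
    by_cases hS : b S = ⊤
    · exact ⟨0, fun h => absurd hS h⟩
    · exact (hint S hS).imp fun z hz _ => hz
  choose z hz using hz
  refine ⟨insert (fun _ => -1, -z Finset.univ)
    ((fun S : Finset N => ((fun i => if i ∈ S then 1 else 0 : N → ℤ), z S)) '' {S | b S ≠ ⊤}),
    (Set.toFinite _).insert _, ?_⟩
  ext x
  simp only [Set.mem_ofPred_eq, Set.forall_mem_insert, Set.forall_mem_image, Int.cast_neg,
    Int.cast_one, neg_mul, one_mul, Finset.sum_neg_distrib, neg_le_neg_iff, Int.cast_ite,
    Int.cast_zero, ite_mul, zero_mul, Finset.sum_ite_mem, Finset.univ_inter]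
  rw [mem_base_iff, hz _ h, WithTop.coe_inj]
  simp only [sumOn_apply]
  constructor
  · rintro ⟨h1, h2⟩
    refine ⟨h2.ge, fun S hS => ?_⟩
    have := h1 S
    rwa [hz S hS, WithTop.coe_le_coe] at this
  · rintro ⟨h1, h2⟩
    refine ⟨fun S => ?_, le_antisymm (h2 h) h1⟩
    by_cases hS : b S = ⊤
    · simp [hS]
    · rw [hz S hS, WithTop.coe_le_coe]
      exact h2 hS

theorem isIntegerPolyhedron_base {b : Finset N → WithTop ℝ} (hb : IsSubmodular b)
    (hint : ∀ S, b S ≠ ⊤ → ∃ z : ℤ, b S = ((z : ℝ) : WithTop ℝ)) :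
    IsIntegerPolyhedron (base b) :=
  ⟨isRationalPolyhedron_base hint, fun _ hF hne =>
    exists_integer_mem_of_isExposed_base hb hint hF hne⟩

omit [DecidableEq N] in
theorem IsSupport.ne_top_of_isPolytope {b : Finset N → WithTop ℝ} {P : Set (N → ℝ)}
    (hb : IsSupport b P) (hP : IsPolytope P) (S : Finset N) : b S ≠ ⊤ := by
  obtain ⟨s, hs, rfl⟩ := hP
  obtain ⟨M, hM⟩ := (hs.isCompact_convexHull ℝ).bddAbove_image
    (LinearMap.continuous_of_finiteDimensional (sumOn S)).continuousOn
  obtain ⟨x, -, hx⟩ := (hb S).2 M fun y hy => hM ⟨y, hy, rfl⟩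
  simp [hx]

-- The maximizers of x(S) form a face, which contains an integer point.
omit [DecidableEq N] in
theorem IsSupport.exists_int_eq {b : Finset N → WithTop ℝ} {P : Set (N → ℝ)}
    (hb : IsSupport b P) (hP : IsIntegerPolyhedron P) {S : Finset N} (hS : b S ≠ ⊤) :
    ∃ z : ℤ, b S = ((z : ℝ) : WithTop ℝ) := by
  obtain ⟨x, hx, -, hmax⟩ := hb.exists_eq hS
  obtain ⟨z, hz, hzmax⟩ := hP.2 {x ∈ P | ∀ y ∈ P, sumOn S y ≤ sumOn S x}
    (fun _ => ⟨LinearMap.toContinuousLinearMap (sumOn S), rfl⟩) ⟨x, hx, hmax⟩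
  refine ⟨∑ i ∈ S, z i, ?_⟩
  rw [hb.eq_of_isMax hz hzmax, sumOn_apply, Int.cast_sum]

/-- Every root polyhedron is the base polyhedron of a submodular function, which is finite or
integer when the polyhedron is bounded or integer. -/
theorem exists_eq_base {P : Set (N → ℝ)} (hP : P ∈ rootPolyhedra N) :
    ∃ b : Finset N → WithTop ℝ, IsSubmodular b ∧ P = base b ∧
      (IsPolytope P → ∀ S, b S ≠ ⊤) ∧
      (IsIntegerPolyhedron P → ∀ S, b S ≠ ⊤ → ∃ z : ℤ, b S = ((z : ℝ) : WithTop ℝ)) := by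
  rcases P.eq_empty_or_nonempty with rfl | hne
  -- A negative value at ∅ contradicts x(∅) = 0, so the constant -1 represents the empty polyhedron.
  · refine ⟨fun _ => ((-1 : ℝ) : WithTop ℝ), fun _ _ => le_rfl, ?_, fun _ _ => WithTop.coe_ne_top,
      fun _ _ _ => ⟨-1, by simp⟩⟩
    refine (Set.eq_empty_iff_forall_notMem.2 fun x hx => ?_).symm
    have := (mem_base_iff.1 hx).1 ∅
    rw [WithTop.coe_le_coe, sumOn_apply, Finset.sum_empty] at this
    norm_num at this
  · obtain ⟨b, hb⟩ := exists_isSupport hP.1 hne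
    exact ⟨b, hb.isSubmodular hP, hb.eq_base hP hne, hb.ne_top_of_isPolytope,
      fun h _ hS => hb.exists_int_eq h hS⟩

omit [Fintype N] in
theorem isSubmodular_coe_iff {b : Finset N → ℝ} :
    IsSubmodular (fun S => (b S : WithTop ℝ)) ↔ IsSubmodular b := by
  refine forall_congr' fun S => forall_congr' fun T => ?_
  beta_reduce
  norm_cast

omit [Fintype N] in
theorem isSubmodular_intCast_iff {b : Finset N → ℤ} :
    IsSubmodular (fun S => (b S : ℝ)) ↔ IsSubmodular b := by
  refine forall_congr' fun S => forall_congr' fun T => ?_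
  beta_reduce
  norm_cast

omit [Fintype N] in
theorem isSubmodular_map_intCast_iff {b : Finset N → WithTop ℤ} :
    IsSubmodular (fun S => (b S).map fun z : ℤ => (z : ℝ)) ↔ IsSubmodular b := by
  refine forall_congr' fun S => forall_congr' fun T => ?_
  beta_reduce
  generalize b (S ∪ T) = p, b (S ∩ T) = q, b S = u, b T = v
  cases p <;> cases q <;> cases u <;> cases v <;>
    simp only [WithTop.map_top, WithTop.map_coe, top_add, add_top, le_refl, le_top, top_le_iff,
      ← WithTop.coe_add, WithTop.coe_ne_top, WithTop.coe_le_coe] <;> norm_cast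

theorem rootPolyhedra_eq_basePolyhedra : rootPolyhedra N = basePolyhedra N := by
  ext P
  constructor
  · intro hP
    obtain ⟨b, hb, h, -⟩ := exists_eq_base hP
    exact ⟨b, hb, h⟩
  · rintro ⟨b, hb, rfl⟩
    exact base_mem_rootPolyhedra hb

theorem rootPolytopes_eq_basePolytopes : rootPolytopes N = basePolytopes N := by
  ext P
  constructor
  · rintro ⟨hP, hpt⟩
    obtain ⟨b, hb, h, hfin, -⟩ := exists_eq_base hP
    choose a ha using fun S => WithTop.ne_top_iff_exists.1 (hfin hpt S)
    obtain rfl : (fun S => (a S : WithTop ℝ)) = b := funext ha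
    exact ⟨a, isSubmodular_coe_iff.1 hb, h⟩
  · rintro ⟨b, hb, rfl⟩
    exact ⟨base_mem_rootPolyhedra (isSubmodular_coe_iff.2 hb), isPolytope_base b⟩

theorem integer_rootPolyhedra_eq :
    {P ∈ rootPolyhedra N | IsIntegerPolyhedron P} = integerBasePolyhedra N := by
  ext P
  constructor
  · rintro ⟨hP, hi⟩
    obtain ⟨b, hb, h, -, hint⟩ := exists_eq_base hP
    have hm : ∀ S, ∃ m : WithTop ℤ, (m.map fun z : ℤ => (z : ℝ)) = b S := fun S => by
      by_cases hS : b S = ⊤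
      · exact ⟨⊤, hS.symm⟩
      · obtain ⟨z, hz⟩ := hint hi S hS
        exact ⟨z, hz.symm⟩
    choose m hm using hm
    obtain rfl : (fun S => (m S).map fun z : ℤ => (z : ℝ)) = b := funext hm
    exact ⟨m, isSubmodular_map_intCast_iff.1 hb, h⟩
  · rintro ⟨b, hb, rfl⟩
    have hb' := isSubmodular_map_intCast_iff.2 hb
    refine ⟨base_mem_rootPolyhedra hb', isIntegerPolyhedron_base hb' fun S hS => ?_⟩
    cases h : b S with
    | top => simp [h] at hS
    | coe z => exact ⟨z, rfl⟩

theorem integer_rootPolytopes_eq :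
    {P ∈ rootPolytopes N | IsIntegerPolyhedron P} = integerBasePolytopes N := by
  ext P
  constructor
  · rintro ⟨⟨hP, hpt⟩, hi⟩
    obtain ⟨b, hb, h, hfin, hint⟩ := exists_eq_base hP
    choose z hz using fun S => hint hi S (hfin hpt S)
    obtain rfl : b = fun S => ((z S : ℝ) : WithTop ℝ) := funext hz
    exact ⟨z, isSubmodular_intCast_iff.1 (isSubmodular_coe_iff.1 hb), h⟩
  · rintro ⟨b, hb, rfl⟩
    have hb' := isSubmodular_coe_iff.2 (isSubmodular_intCast_iff.2 hb)
    exact ⟨⟨base_mem_rootPolyhedra hb', isPolytope_base _⟩,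
      isIntegerPolyhedron_base hb' fun S _ => ⟨b S, rfl⟩⟩

end Main
end DiscreteConvexity

theorem proposition10 (N : Type*) [Fintype N] [DecidableEq N] :
    DiscreteConvexity.rootPolytopes N = DiscreteConvexity.basePolytopes N ∧
    {P ∈ DiscreteConvexity.rootPolytopes N | DiscreteConvexity.IsIntegerPolyhedron P} =
      DiscreteConvexity.integerBasePolytopes N ∧
    DiscreteConvexity.rootPolyhedra N = DiscreteConvexity.basePolyhedra N ∧
    {P ∈ DiscreteConvexity.rootPolyhedra N | DiscreteConvexity.IsIntegerPolyhedron P} =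
      DiscreteConvexity.integerBasePolyhedra N :=
  ⟨DiscreteConvexity.rootPolytopes_eq_basePolytopes, DiscreteConvexity.integer_rootPolytopes_eq,
    DiscreteConvexity.rootPolyhedra_eq_basePolyhedra, DiscreteConvexity.integer_rootPolyhedra_eq⟩
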